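/- Let $n\ge 1$ be an integer and let $p\ge 2$ be a real number. There is a constant $C_{n,p}>0$, depending only on $n$ and $p$, such that the following holds. Let $\mu$ be a probability measure on $\mathbb{R}^n$ that is absolutely continuous with respect to Lebesgue measure, and suppose that $$\int_{(\mathbb{R}^n)^n} |\det[x_1\cdots x_n]|^p \, d\mu^{\otimes n}(x_1,\ldots,x_n)<\infty,$$ where $[x_1\cdots x_n]$ is the matrix with columns $x_1,\ldots,x_n$. Define $f:(\mathbb{R}^n)^n\to\mathbb{R}$ by $$f(x_1,\ldots,x_n)=|\det[x_1\cdots x_n]|-\int_{(\mathbb{R}^n)^n}|\det[y_1\cdots y_n]|\,d\mu^{\otimes n}(y_1,\ldots,y_n).$$ Then for every positive integer $N$ and all independent random vectors $X_1,\ldots,X_N$ in $\mathbb{R}^n$ with common law $\mu$, the expectation on the left below is finite and $$\mathbb{E}\,\Bigl|\sum_{1\le i_1<\cdots<i_n\le N} f(X_{i_1},\ldots,X_{i_n})\Bigr|^p\le C_{n,p}\,N^{p(n-\frac12)}\int_{(\mathbb{R}^n)^n}|f|^p\,d\mu^{\otimes n}.$$ When $N\ge n$, the integrals against $\mu^{\otimes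 n}$ are the expectations $\mathbb{E}|\det[X_1\cdots X_n]|^p$, $\mathbb{E}|\det[X_1\cdots X_n]|$ and $\mathbb{E}|f(X_1,\ldots,X_n)|^p$. -/

import Mathlib

open MeasureTheory ProbabilityTheory

noncomputable section

/-- The absolute value of the determinant of the matrix `[x_1 ⋯ x_n]` whose columns are the
vectors `x_1, …, x_n` of `ℝⁿ`. -/
def absDet {n : ℕ} (x : Fin n → EuclideanSpace ℝ (Fin n)) : ℝ :=
  |(Matrix.of fun i j : Fin n => x j i).det|

/-- The joint law of `n` independent random vectors of `ℝⁿ`, each with law `μ`. -/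
def iidLaw {n : ℕ} (μ : Measure (EuclideanSpace ℝ (Fin n))) :
    Measure (Fin n → EuclideanSpace ℝ (Fin n)) :=
  Measure.pi fun _ => μ

/-- The centred kernel `f(x_1, …, x_n) = |det [x_1 ⋯ x_n]| - E |det [X_1 ⋯ X_n]|`, where
`X_1, …, X_n` are independent with law `μ`. -/
def detKernel {n : ℕ} (μ : Measure (EuclideanSpace ℝ (Fin n)))
    (x : Fin n → EuclideanSpace ℝ (Fin n)) : ℝ :=
  absDet x - ∫ y, absDet y ∂(iidLaw μ)

/-- The sum `∑_{1 ≤ i_1 < ⋯ < i_n ≤ N} f(x_{i_1}, …, x_{i_n})`; the increasing `n`-tuples of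
indices are the order embeddings of `Fin n` into `Fin N`. -/
def increasingSum {n N : ℕ} {E : Type*} (f : (Fin n → E) → ℝ) (x : Fin N → E) : ℝ :=
  ∑ i : Fin n ↪o Fin N, f fun k => x (i k)

end

/-!
The absolute determinant is a symmetric function of its columns, so the sum is, up to a binomial
factor, a U-statistic with a symmetric mean-zero kernel `f`. The bound follows from Hoeffding's
representation of a U-statistic as an average of sums of independent terms.

Put `k = ⌊N / n⌋` and fix `k` disjoint blocks of `n` indices. For a permutation `σ` of the `N`
indices let `T_σ` be the sum of `f` over the `k` blocks permuted by `σ`. By symmetry of `f` and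
transitivity of the symmetric group on injective `n`-tuples, the sum over increasing tuples equals
`(M / k)` times the average of the `T_σ`, where `M ≤ N ^ n` is the number of increasing tuples
(`mul_sum_orderEmbedding_eq`). By Jensen's inequality the `p`-th moment of the sum is at most
`(M / k) ^ p` times the largest `p`-th moment of a `T_σ`.

Each `T_σ` is a sum of `k` independent centred copies of `f(X_1, …, X_n)`
(`iIndepFun_blocks`), so its `p`-th moment is at most a constant times
`k ^ (p / 2) * E |f| ^ p`. This Marcinkiewicz–Zygmund type bound (`integral_abs_sum_rpow_le`) is
proved by adding one summand at a time, from the pointwise inequality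
`|a + b| ^ p ≤ |a| ^ p + p a |a| ^ (p - 2) b + C (|a| ^ (p - 2) b ^ 2 + |b| ^ p)`: the linear term
has mean zero, and the other terms are controlled by Lyapunov's inequality. As `k` is comparable
with `N / n`, the factor `(N ^ n / k) ^ p * k ^ (p / 2)` is of order `N ^ (p * (n - 1 / 2))`.
-/

/-! ### Inequalities for real powers -/

/-- Bernoulli's inequality at `s⁻¹`: the convex function `s ↦ s ^ r` lies above its tangent at `s`,
compared at the point `1`. -/
theorem rpow_sub_one_le_mul {r s : ℝ} (hr : 1 ≤ r) (hs : 0 < s) :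
    s ^ r - 1 ≤ r * (s - 1) * s ^ (r - 1) := by
  have h := one_add_mul_self_le_rpow_one_add (s := s⁻¹ - 1) (by
    have : 0 < s⁻¹ := inv_pos.2 hs
    linarith) hr
  have e : 1 + (s⁻¹ - 1) = s⁻¹ := by ring
  rw [e, Real.inv_rpow hs.le] at h
  have hsr : 0 < s ^ r := Real.rpow_pos_of_pos hs r
  have h2 := mul_le_mul_of_nonneg_right h hsr.le
  rw [inv_mul_cancel₀ hsr.ne'] at h2
  have e2 : s ^ r = s ^ (r - 1) * s := by
    rw [← Real.rpow_add_one hs.ne']; ring_nf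
  have e3 : (1 + r * (s⁻¹ - 1)) * s ^ r = s ^ r - r * (s - 1) * s ^ (r - 1) := by
    rw [e2]; field_simp; ring
  linarith

/-- Taylor bound at `1` with an explicit quadratic remainder, valid for negative `t` as well. -/
theorem one_add_rpow_le {p t : ℝ} (hp : 2 ≤ p) (ht : |t| < 1) :
    (1 + t) ^ p ≤ 1 + p * t + p ^ 2 * 2 ^ p * t ^ 2 := by
  obtain ⟨h1, h2⟩ := abs_lt.1 ht
  have hs : 0 < 1 + t := by linarith
  have hA := rpow_sub_one_le_mul (r := p) (s := 1 + t) (by linarith) hs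
  -- Convexity gives `(1 + t) ^ p - 1 ≤ p t (1 + t) ^ (p - 1)`; the excess of the right side over
  -- `p t` is quadratic in `t`.
  have hL : t * ((1 + t) ^ (p - 1) - 1) ≤ p * 2 ^ p * t ^ 2 := by
    have h2p : (1 : ℝ) ≤ 2 ^ p := Real.one_le_rpow (by norm_num) (by linarith)
    rcases le_total 0 t with h0 | h0
    · have hB := rpow_sub_one_le_mul (r := p - 1) (s := 1 + t) (by linarith) hs
      have hC : (1 + t) ^ (p - 1 - 1) ≤ 2 ^ p :=
        (Real.rpow_le_rpow hs.le (by linarith) (by linarith)).trans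
          (Real.rpow_le_rpow_of_exponent_le (by norm_num) (by linarith))
      have hD : (1 + t) ^ (p - 1) - 1 ≤ p * t * 2 ^ p := by
        refine hB.trans ?_
        have : (p - 1) * (1 + t - 1) ≤ p * t := by nlinarith
        exact mul_le_mul this hC (by positivity) (by positivity)
      calc _ ≤ t * (p * t * 2 ^ p) := by gcongr
        _ = _ := by ring
    · have hB := one_add_mul_self_le_rpow_one_add (s := t) (by linarith) (p := p - 1) (by linarith)
      have : t * ((1 + t) ^ (p - 1) - 1) ≤ t * ((p - 1) * t) :=
        mul_le_mul_of_nonpos_left (by linarith) h0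
      have h3 : p - 1 ≤ p * 2 ^ p := by nlinarith
      nlinarith [sq_nonneg t]
  have : (1 + t) ^ p - 1 ≤ p * t + p * (t * ((1 + t) ^ (p - 1) - 1)) := by
    refine hA.trans (le_of_eq ?_); ring
  have h5 : p * (t * ((1 + t) ^ (p - 1) - 1)) ≤ p * (p * 2 ^ p * t ^ 2) := by gcongr
  nlinarith

/-- A second-order expansion of `|a + b| ^ p` at `a` for `p ≥ 2`, with an error that is quadratic
in `b` when `|b| < |a|` and of order `|b| ^ p` otherwise. For `p = 2` and `a = 0` the convention
`0 ^ 0 = 1` makes the error term `C * (b ^ 2 + b ^ 2)`, and the inequality still holds. -/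
theorem abs_add_rpow_le {p : ℝ} (hp : 2 ≤ p) (a b : ℝ) :
    |a + b| ^ p ≤ |a| ^ p + p * (a * |a| ^ (p - 2) * b) +
      p ^ 2 * 2 ^ p * (|a| ^ (p - 2) * b ^ 2 + |b| ^ p) := by
  have h2p : (1 : ℝ) ≤ 2 ^ p := Real.one_le_rpow (by norm_num) (by linarith)
  rcases le_or_gt |a| |b| with h | h
  · have h1 : |a + b| ^ p ≤ 2 ^ p * |b| ^ p := by
      rw [← Real.mul_rpow (by norm_num) (abs_nonneg b)]
      refine Real.rpow_le_rpow (abs_nonneg _) ?_ (by linarith)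
      linarith [abs_add_le a b]
    have h3 : -(a * |a| ^ (p - 2) * b) ≤ |b| ^ p := by
      refine (neg_le_abs _).trans ?_
      rw [abs_mul, abs_mul, abs_of_nonneg (Real.rpow_nonneg (abs_nonneg a) (p - 2))]
      calc |a| * |a| ^ (p - 2) * |b| ≤ |b| * |b| ^ (p - 2) * |b| := by
            gcongr
        _ = |b| ^ p := by
            rcases eq_or_ne b 0 with rfl | hb
            · simp; rw [Real.zero_rpow (by linarith)]
            · have hb' : 0 < |b| := abs_pos.2 hb
              have : p = (p - 2) + 1 + 1 := by ring
              conv_rhs => rw [this, Real.rpow_add_one hb'.ne', Real.rpow_add_one hb'.ne']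
              ring
    have h4 : 0 ≤ |a| ^ p := by positivity
    have h5 : 0 ≤ |a| ^ (p - 2) * b ^ 2 := by positivity
    have h6 : 0 ≤ |b| ^ p := by positivity
    have h7 : 2 ^ p + p ≤ p ^ 2 * 2 ^ p := by
      nlinarith [mul_nonneg (by nlinarith : 0 ≤ p ^ 2 - 1) (by linarith : 0 ≤ (2 : ℝ) ^ p - 1)]
    nlinarith [mul_le_mul_of_nonneg_right h7 h6, mul_nonneg (by positivity : 0 ≤ p ^ 2 * (2:ℝ) ^ p) h5]
  · have ha : 0 < |a| := (abs_nonneg b).trans_lt h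
    have ha0 : a ≠ 0 := abs_pos.1 ha
    have ht : |b / a| < 1 := by rw [abs_div, div_lt_one ha]; exact h
    have hm := one_add_rpow_le hp ht
    have hs : 0 ≤ 1 + b / a := by linarith [(abs_lt.1 ht).1]
    have e1 : |a + b| ^ p = |a| ^ p * (1 + b / a) ^ p := by
      rw [← Real.mul_rpow ha.le hs]
      congr 1
      rw [← abs_of_nonneg hs, ← abs_mul]
      congr 1; field_simp
    have e2 : |a| ^ p = |a| ^ (p - 2) * a ^ 2 := by
      have : p = (p - 2) + 1 + 1 := by ring
      conv_lhs => rw [this, Real.rpow_add_one ha.ne', Real.rpow_add_one ha.ne']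
      rw [mul_assoc, ← sq, sq_abs]
    have h6 : 0 ≤ |b| ^ p := by positivity
    rw [e1]
    refine (mul_le_mul_of_nonneg_left hm (by positivity)).trans ?_
    have e3 : |a| ^ p * (1 + p * (b / a) + p ^ 2 * 2 ^ p * (b / a) ^ 2) =
        |a| ^ p + p * (a * |a| ^ (p - 2) * b) + p ^ 2 * 2 ^ p * (|a| ^ (p - 2) * b ^ 2) := by
      rw [e2]; field_simp
    rw [e3]
    nlinarith [mul_nonneg (by positivity : 0 ≤ p ^ 2 * (2:ℝ) ^ p) h6]

/-- The numerical step of the induction on the number of summands, with `q = p / 2`. The case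
`k = 0` is stated apart because for `q = 1` the term `0 ^ (q - 1)` is `1`. -/
theorem rpow_add_rpow_sub_one_le {q : ℝ} (hq : 1 ≤ q) {A k : ℝ} (hA : 1 ≤ A) (hk : k = 0 ∨ 1 ≤ k) :
    (2 * A * k) ^ q + A * ((2 * A * k) ^ (q - 1) + 1) ≤ (2 * A * (k + 1)) ^ q := by
  have hK : (1 : ℝ) ≤ 2 * A := by linarith
  obtain ⟨K, hKA⟩ : ∃ K, K = 2 * A := ⟨_, rfl⟩
  rw [← hKA] at hK ⊢
  have hK1 : 1 ≤ K ^ (q - 1) := Real.one_le_rpow hK (by linarith)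
  have eK : K ^ q = K ^ (q - 1) * K := by
    rw [← Real.rpow_add_one (by linarith)]; ring_nf
  rcases hk with rfl | hk
  · have h1 : (0 : ℝ) ^ (q - 1) ≤ 1 := Real.rpow_le_one le_rfl zero_le_one (by linarith)
    rw [mul_zero, Real.zero_rpow (by linarith), zero_add, zero_add, mul_one, eK]
    nlinarith
  · have hk0 : 0 < k := by linarith
    have h1 : k ^ q + k ^ (q - 1) ≤ (k + 1) ^ q := by
      have := one_add_mul_self_le_rpow_one_add (s := k⁻¹) (by
        have : 0 < k⁻¹ := inv_pos.2 hk0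
        linarith) hq
      have e : (k + 1) ^ q = k ^ q * (1 + k⁻¹) ^ q := by
        rw [← Real.mul_rpow hk0.le (by positivity)]; congr 1; field_simp
      have e2 : k ^ q = k ^ (q - 1) * k := by
        rw [← Real.rpow_add_one hk0.ne']; ring_nf
      rw [e]
      refine le_trans ?_ (mul_le_mul_of_nonneg_left this (by positivity))
      have : k ^ q * (1 + q * k⁻¹) = k ^ q + q * k ^ (q - 1) := by rw [e2]; field_simp
      rw [this]
      have : 0 ≤ k ^ (q - 1) := by positivity
      nlinarith
    have h2 : 1 ≤ k ^ (q - 1) := Real.one_le_rpow hk (by linarith)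
    rw [Real.mul_rpow (by linarith) hk0.le, Real.mul_rpow (by linarith) hk0.le,
      Real.mul_rpow (by linarith) (by linarith)]
    have h3 : 1 ≤ K ^ (q - 1) * k ^ (q - 1) := one_le_mul_of_one_le_of_one_le hK1 h2
    have h4 := mul_le_mul_of_nonneg_left h1 (by positivity : 0 ≤ K ^ q)
    rw [eK] at h4 ⊢
    nlinarith

/-! ### Moments of sums of independent centred variables -/

/-- Lyapunov's inequality for absolute moments on a probability space. The exponent `r = 0` is
allowed. -/
theorem integral_rpow_le_rpow_integral {Ω : Type*} [MeasurableSpace Ω] {P : Measure Ω}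
    [IsProbabilityMeasure P] {g : Ω → ℝ} {r p : ℝ} (hg : AEStronglyMeasurable g P)
    (hr : 0 ≤ r) (hp : 0 < p) (hrp : r ≤ p) (hi : Integrable (fun ω => |g ω| ^ p) P) :
    ∫ ω, |g ω| ^ r ∂P ≤ (∫ ω, |g ω| ^ p ∂P) ^ (r / p) := by
  have e : ∀ ω, (|g ω| ^ p) ^ (r / p) = |g ω| ^ r := fun ω => by
    rw [← Real.rpow_mul (abs_nonneg _)]; congr 1; field_simp
  have hri : Integrable (fun ω => |g ω| ^ r) P :=
    integrable_norm_rpow_of_le hg hr hp.le hrp hi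
  have h := (Real.concaveOn_rpow (p := r / p) (by positivity)
    (by rw [div_le_one hp]; exact hrp)).le_map_integral (μ := P) (f := fun ω => |g ω| ^ p)
    (Real.continuous_rpow_const (by positivity)).continuousOn isClosed_Ici
    (Filter.Eventually.of_forall fun ω => Set.mem_Ici.2 (by positivity)) hi
    (by simpa only [Function.comp_def, e] using hri)
  simpa only [e] using h

theorem integrable_abs_add_rpow {Ω : Type*} [MeasurableSpace Ω] {P : Measure Ω}
    {S Y : Ω → ℝ} {p : ℝ} (hp : 0 < p) (hS : AEStronglyMeasurable S P)
    (hY : AEStronglyMeasurable Y P) (hSi : Integrable (fun ω => |S ω| ^ p) P)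
    (hYi : Integrable (fun ω => |Y ω| ^ p) P) :
    Integrable (fun ω => |S ω + Y ω| ^ p) P := by
  have e : (ENNReal.ofReal p).toReal = p := ENNReal.toReal_ofReal hp.le
  have key : ∀ {Z : Ω → ℝ}, AEStronglyMeasurable Z P →
      (Integrable (fun ω => |Z ω| ^ p) P ↔ MemLp Z (ENNReal.ofReal p) P) := fun {Z} hZ => by
    have := integrable_norm_rpow_iff hZ (p := ENNReal.ofReal p)
      (by simpa using hp) ENNReal.ofReal_ne_top
    rwa [e] at this
  exact (key (hS.add hY)).2 (((key hS).1 hSi).add ((key hY).1 hYi))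

/-- The effect on the `p`-th moment of adding an independent centred summand: by independence the
linear term of `abs_add_rpow_le` integrates to zero. -/
theorem integral_abs_add_rpow_le {Ω : Type*} [MeasurableSpace Ω] {P : Measure Ω}
    [IsProbabilityMeasure P] {S Y : Ω → ℝ} {p : ℝ} (hp : 2 ≤ p) (hS : AEMeasurable S P)
    (hY : AEMeasurable Y P) (hSY : IndepFun S Y P) (hSi : Integrable (fun ω => |S ω| ^ p) P)
    (hYi : Integrable (fun ω => |Y ω| ^ p) P) (hY0 : ∫ ω, Y ω ∂P = 0) :
    ∫ ω, |S ω + Y ω| ^ p ∂P ≤ ∫ ω, |S ω| ^ p ∂P + p ^ 2 * 2 ^ p *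
      ((∫ ω, |S ω| ^ p ∂P) ^ ((p - 2) / p) * (∫ ω, |Y ω| ^ p ∂P) ^ (2 / p) +
        ∫ ω, |Y ω| ^ p ∂P) := by
  have hp0 : 0 < p := by linarith
  have hY1 : Integrable Y P := by
    have h := integrable_norm_rpow_of_le (p := 1) hY.aestronglyMeasurable zero_le_one hp0.le
      (by linarith) hYi
    simp only [Real.rpow_one] at h
    exact (integrable_norm_iff hY.aestronglyMeasurable).1 h
  have hY2 : Integrable (fun ω => Y ω ^ 2) P := by
    have h := integrable_norm_rpow_of_le (p := 2) hY.aestronglyMeasurable zero_le_two hp0.le hp hYi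
    simpa only [Real.rpow_two, Real.norm_eq_abs, sq_abs] using h
  have hS2 : Integrable (fun ω => |S ω| ^ (p - 2)) P :=
    integrable_norm_rpow_of_le hS.aestronglyMeasurable (by linarith) hp0.le (by linarith) hSi
  have hmS2 : Measurable fun a : ℝ => |a| ^ (p - 2) := by fun_prop
  have hS1 : Integrable (fun ω => S ω * |S ω| ^ (p - 2)) P := by
    refine Integrable.mono' (g := fun ω => |S ω| ^ (p - 1))
      (integrable_norm_rpow_of_le hS.aestronglyMeasurable (by linarith) hp0.le (by linarith) hSi)
      (hS.mul (hmS2.comp_aemeasurable hS)).aestronglyMeasurable (Filter.Eventually.of_forall fun ω => ?_)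
    rw [norm_mul, Real.norm_of_nonneg (by positivity : 0 ≤ |S ω| ^ (p - 2)), Real.norm_eq_abs]
    rcases eq_or_ne (S ω) 0 with h | h
    · rw [h, abs_zero, zero_mul]; positivity
    · have : p - 1 = (p - 2) + 1 := by ring
      rw [this, Real.rpow_add_one (abs_ne_zero.2 h), mul_comm]
  have hind1 : IndepFun (fun ω => S ω * |S ω| ^ (p - 2)) Y P :=
    hSY.comp (φ := fun a : ℝ => a * |a| ^ (p - 2)) (ψ := id) (by fun_prop) measurable_id
  have hind2 : IndepFun (fun ω => |S ω| ^ (p - 2)) (fun ω => Y ω ^ 2) P :=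
    hSY.comp (φ := fun a : ℝ => |a| ^ (p - 2)) (ψ := fun b => b ^ 2) (by fun_prop) (by fun_prop)
  have hi1 : Integrable (fun ω => S ω * |S ω| ^ (p - 2) * Y ω) P := hind1.integrable_mul hS1 hY1
  have hi2 : Integrable (fun ω => |S ω| ^ (p - 2) * Y ω ^ 2) P := hind2.integrable_mul hS2 hY2
  have he1 : ∫ ω, S ω * |S ω| ^ (p - 2) * Y ω ∂P = 0 := by
    rw [hind1.integral_fun_mul_eq_mul_integral hS1.aestronglyMeasurable hY1.aestronglyMeasurable,
      hY0, mul_zero]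
  have he2 : ∫ ω, |S ω| ^ (p - 2) * Y ω ^ 2 ∂P ≤
      (∫ ω, |S ω| ^ p ∂P) ^ ((p - 2) / p) * (∫ ω, |Y ω| ^ p ∂P) ^ (2 / p) := by
    rw [hind2.integral_fun_mul_eq_mul_integral hS2.aestronglyMeasurable hY2.aestronglyMeasurable]
    have h2 := integral_rpow_le_rpow_integral (r := 2) hY.aestronglyMeasurable zero_le_two hp0 hp hYi
    simp only [Real.rpow_two, sq_abs] at h2
    exact mul_le_mul (integral_rpow_le_rpow_integral hS.aestronglyMeasurable (by linarith) hp0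
      (by linarith) hSi) h2 (integral_nonneg fun ω => sq_nonneg _)
      (Real.rpow_nonneg (integral_nonneg fun ω => by positivity) _)
  calc ∫ ω, |S ω + Y ω| ^ p ∂P
      ≤ ∫ ω, (|S ω| ^ p + p * (S ω * |S ω| ^ (p - 2) * Y ω) +
          p ^ 2 * 2 ^ p * (|S ω| ^ (p - 2) * Y ω ^ 2 + |Y ω| ^ p)) ∂P :=
        integral_mono (integrable_abs_add_rpow hp0 hS.aestronglyMeasurable hY.aestronglyMeasurable
          hSi hYi) ((hSi.add (hi1.const_mul p)).add ((hi2.add hYi).const_mul _))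
          fun ω => abs_add_rpow_le hp _ _
    _ = ∫ ω, |S ω| ^ p ∂P + p ^ 2 * 2 ^ p *
          (∫ ω, |S ω| ^ (p - 2) * Y ω ^ 2 ∂P + ∫ ω, |Y ω| ^ p ∂P) := by
        have h1 : Integrable (fun ω => |S ω| ^ p + p * (S ω * |S ω| ^ (p - 2) * Y ω)) P :=
          hSi.add (hi1.const_mul p)
        have h2 : Integrable (fun ω => |S ω| ^ (p - 2) * Y ω ^ 2 + |Y ω| ^ p) P := hi2.add hYi
        rw [integral_add h1 (h2.const_mul _), integral_add hSi (hi1.const_mul p),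
          integral_const_mul, he1, integral_const_mul, integral_add hi2 hYi, mul_zero, add_zero]
    _ ≤ _ := by gcongr

/-- A Marcinkiewicz–Zygmund type inequality: for `p ≥ 2` the `p`-th moment of a sum of independent
centred variables grows like the number of summands to the power `p / 2`. -/
theorem integral_abs_sum_rpow_le {Ω ι : Type*} [MeasurableSpace Ω] {P : Measure Ω}
    [IsProbabilityMeasure P] {Y : ι → Ω → ℝ} {p m : ℝ} (hp : 2 ≤ p)
    (hY : ∀ i, AEMeasurable (Y i) P) (hind : iIndepFun Y P)
    (hYi : ∀ i, Integrable (fun ω => |Y i ω| ^ p) P) (hY0 : ∀ i, ∫ ω, Y i ω ∂P = 0)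
    (hm : ∀ i, ∫ ω, |Y i ω| ^ p ∂P ≤ m) (s : Finset ι) :
    Integrable (fun ω => |∑ i ∈ s, Y i ω| ^ p) P ∧
      ∫ ω, |∑ i ∈ s, Y i ω| ^ p ∂P ≤ (2 * (p ^ 2 * 2 ^ p) * (s.card : ℝ)) ^ (p / 2) * m := by
  classical
  have hp0 : 0 < p := by linarith
  induction s using Finset.induction_on with
  | empty =>
    simp [Real.zero_rpow hp0.ne', Real.zero_rpow (half_pos hp0).ne']
  | insert i s hi ih =>
    obtain ⟨ih1, ih2⟩ := ih
    have hm0 : 0 ≤ m := (integral_nonneg fun ω => by positivity).trans (hm i)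
    have hSm : AEMeasurable (fun ω => ∑ j ∈ s, Y j ω) P := Finset.aemeasurable_fun_sum s fun j _ => hY j
    have hSY : IndepFun (fun ω => ∑ j ∈ s, Y j ω) (Y i) P := by
      have := hind.indepFun_finsetSum_of_notMem₀ hY hi
      rwa [show ∑ j ∈ s, Y j = fun ω => ∑ j ∈ s, Y j ω from by ext; simp] at this
    have e : ∀ ω, ∑ j ∈ insert i s, Y j ω = ∑ j ∈ s, Y j ω + Y i ω := fun ω => by
      rw [Finset.sum_insert hi, add_comm]
    simp only [e]
    refine ⟨integrable_abs_add_rpow hp0 hSm.aestronglyMeasurable (hY i).aestronglyMeasurable ih1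
      (hYi i), ?_⟩
    refine (integral_abs_add_rpow_le hp hSm (hY i) hSY ih1 (hYi i) (hY0 i)).trans ?_
    set A : ℝ := p ^ 2 * 2 ^ p
    have hA : 1 ≤ A := by
      have h2p : (1 : ℝ) ≤ 2 ^ p := Real.one_le_rpow (by norm_num) (by linarith)
      exact one_le_mul_of_one_le_of_one_le (by nlinarith) h2p
    set k : ℝ := (s.card : ℝ) with hk
    have hk0 : 0 ≤ k := by positivity
    have h1 : (∫ ω, |∑ j ∈ s, Y j ω| ^ p ∂P) ^ ((p - 2) / p) * (∫ ω, |Y i ω| ^ p ∂P) ^ (2 / p) ≤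
        (2 * A * k) ^ (p / 2 - 1) * m := by
      have hr : 0 ≤ (p - 2) / p := div_nonneg (by linarith) hp0.le
      calc _ ≤ ((2 * A * k) ^ (p / 2) * m) ^ ((p - 2) / p) * m ^ (2 / p) := by
            refine mul_le_mul (Real.rpow_le_rpow (integral_nonneg fun ω => by positivity) ih2 hr)
              (Real.rpow_le_rpow (integral_nonneg fun ω => by positivity) (hm i) (by positivity))
              (Real.rpow_nonneg (integral_nonneg fun ω => by positivity) _) (by positivity)
        _ = _ := by
            rw [Real.mul_rpow (by positivity) hm0, ← Real.rpow_mul (by positivity), mul_assoc,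
              ← Real.rpow_add_of_nonneg hm0 hr (by positivity)]
            have e1 : p / 2 * ((p - 2) / p) = p / 2 - 1 := by field_simp
            have e2 : (p - 2) / p + 2 / p = 1 := by field_simp; ring
            rw [e1, e2, Real.rpow_one]
    have h2 := rpow_add_rpow_sub_one_le (q := p / 2) (by linarith) hA (k := k) (by
      rcases Nat.eq_zero_or_pos s.card with h | h
      · left; rw [hk, h, Nat.cast_zero]
      · right; rw [hk]; exact_mod_cast h)
    rw [Finset.card_insert_of_notMem hi, Nat.cast_succ]
    calc _ ≤ (2 * A * k) ^ (p / 2) * m + A * ((2 * A * k) ^ (p / 2 - 1) * m + m) := by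
          gcongr
          exact hm i
      _ = ((2 * A * k) ^ (p / 2) + A * ((2 * A * k) ^ (p / 2 - 1) + 1)) * m := by ring
      _ ≤ _ := by gcongr

/-! ### Symmetric sums over increasing tuples -/

theorem exists_perm_comp_eq_of_range_subset {ι α : Type*} [Finite ι] {a b : ι → α}
    (ha : Function.Injective a) (h : ∀ i, a i ∈ Set.range b) :
    ∃ τ : Equiv.Perm ι, b ∘ τ = a := by
  choose τ hτ using h
  have hinj : Function.Injective τ := fun i j hij => ha (by rw [← hτ i, ← hτ j, hij])
  exact ⟨Equiv.ofBijective τ (Finite.injective_iff_bijective.1 hinj), funext hτ⟩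

/-- A permutation `σ` of `α` acts on the `n`-element subsets of `α`, that is, on the increasing
`n`-tuples; a symmetric function does not see the reordering of `σ ∘ i` that makes it increasing. -/
theorem sum_orderEmbedding_perm_comp {n : ℕ} {α : Type*} [LinearOrder α] [Fintype α]
    {F : (Fin n → α) → ℝ}
    (hF : ∀ (τ : Equiv.Perm (Fin n)) i, F (i ∘ τ) = F i) (σ : Equiv.Perm α) :
    ∑ i : Fin n ↪o α, F (σ ∘ i) = ∑ i : Fin n ↪o α, F i := by
  classical
  have hcard : ∀ i : Fin n ↪o α, (Finset.univ.image (σ ∘ i)).card = n := fun i => by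
    rw [Finset.card_image_of_injective _ (σ.injective.comp i.injective), Finset.card_fin]
  let Φ : (Fin n ↪o α) → (Fin n ↪o α) := fun i =>
    (Finset.univ.image (σ ∘ i)).orderEmbOfFin (hcard i)
  have hrange : ∀ i, Set.range (Φ i) = Set.range (σ ∘ i) := fun i => by
    simp [Φ, Function.comp_def]
  have hinj : Function.Injective Φ := fun i j hij => by
    have h : Set.range (σ ∘ i) = Set.range (σ ∘ j) := by rw [← hrange, ← hrange, hij]
    rw [Set.range_comp, Set.range_comp] at h
    have h' := σ.injective.image_injective h
    exact OrderEmbedding.range_inj.1 h'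
  refine Fintype.sum_bijective Φ (Finite.injective_iff_bijective.1 hinj) _ _ fun i => ?_
  obtain ⟨τ, hτ⟩ := exists_perm_comp_eq_of_range_subset (a := σ ∘ i) (b := Φ i)
    (σ.injective.comp i.injective) fun l => by rw [hrange]; exact Set.mem_range_self l
  rw [← hτ, hF]

/-- The average over all permutations of `α` is the same along any two injective tuples, as the
symmetric group acts transitively on these. -/
theorem sum_perm_comp_eq {ι α : Type*} [Finite ι] [Fintype α] [DecidableEq α]
    (F : (ι → α) → ℝ) {i j : ι → α}
    (hi : Function.Injective i) (hj : Function.Injective j) :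
    ∑ σ : Equiv.Perm α, F (σ ∘ i) = ∑ σ : Equiv.Perm α, F (σ ∘ j) := by
  obtain ⟨τ, hτ⟩ := Equiv.Perm.exists_extending_pair j i hj hi
  rw [← Equiv.sum_comp (Equiv.mulRight τ) fun σ : Equiv.Perm α => F (σ ∘ j)]
  refine Finset.sum_congr rfl fun σ _ => congrArg F (funext fun a => ?_)
  simp [hτ]

/-- Hoeffding's representation: the sum of a symmetric function over increasing tuples is a multiple
of the average, over all permutations `σ`, of its sum over `k` fixed disjoint blocks moved by `σ`. -/
theorem mul_sum_orderEmbedding_eq {n k : ℕ} {α : Type*} [LinearOrder α] [Fintype α]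
    {F : (Fin n → α) → ℝ}
    (hF : ∀ (τ : Equiv.Perm (Fin n)) i, F (i ∘ τ) = F i) {e : Fin k × Fin n → α}
    (he : Function.Injective e) :
    (k : ℝ) * (Fintype.card (Equiv.Perm α) * ∑ i : Fin n ↪o α, F i) =
      Fintype.card (Fin n ↪o α) *
        ∑ σ : Equiv.Perm α, ∑ j : Fin k, F (σ ∘ fun l => e (j, l)) := by
  have h1 : (Fintype.card (Equiv.Perm α) : ℝ) * ∑ i : Fin n ↪o α, F i =
      ∑ i : Fin n ↪o α, ∑ σ : Equiv.Perm α, F (σ ∘ i) := by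
    rw [Finset.sum_comm, Finset.sum_congr rfl fun σ _ => sum_orderEmbedding_perm_comp hF σ]
    simp
  rw [h1, Finset.sum_comm (s := (Finset.univ : Finset (Equiv.Perm α))), Finset.mul_sum,
    Finset.mul_sum]
  have h2 : ∀ j : Fin k, (Fintype.card (Fin n ↪o α) : ℝ) *
      ∑ σ : Equiv.Perm α, F (σ ∘ fun l => e (j, l)) =
        ∑ i : Fin n ↪o α, ∑ σ : Equiv.Perm α, F (σ ∘ i) := fun j => by
    rw [Finset.sum_congr rfl fun (i : Fin n ↪o α) _ => sum_perm_comp_eq F i.injective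
      (j := fun l => e (j, l)) (fun a b hab => (Prod.ext_iff.1 (he hab)).2)]
    simp
  rw [Finset.sum_congr rfl fun j _ => h2 j]
  simp [Finset.mul_sum]

/-! ### Independence of disjoint blocks -/

/-- Disjoint blocks of an i.i.d. family are jointly distributed as a product of product measures. -/
theorem hasLaw_curry_comp {Ω E ι κ η : Type*} [MeasurableSpace Ω] [MeasurableSpace E]
    [Fintype ι] [Fintype κ]
    {P : Measure Ω} [IsProbabilityMeasure P] {μ : Measure E} [IsProbabilityMeasure μ]
    {X : η → Ω → E} (hX : ∀ i, HasLaw (X i) μ P) (hind : iIndepFun X P)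
    {e : ι × κ → η} (he : Function.Injective e) :
    HasLaw (fun ω j l => X (e (j, l)) ω) (Measure.pi fun _ : ι => Measure.pi fun _ : κ => μ) P := by
  have h1 : HasLaw (fun ω q => X (e q) ω) (Measure.pi fun _ : ι × κ => μ) P :=
    (hind.precomp he).hasLaw_pi fun q => hX (e q)
  have h2 : HasLaw (MeasurableEquiv.curry ι κ E)
      (Measure.pi fun _ : ι => Measure.pi fun _ : κ => μ) (Measure.pi fun _ : ι × κ => μ) :=
    ⟨(MeasurableEquiv.curry ι κ E).measurable.aemeasurable, by
      have := Measure.infinitePi_map_curry (fun (_ : ι) (_ : κ) => μ)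
      simpa only [Measure.infinitePi_eq_pi] using this⟩
  exact h2.comp h1

theorem iIndepFun_blocks {Ω E ι κ η : Type*} [MeasurableSpace Ω] [MeasurableSpace E]
    [Fintype ι] [Fintype κ]
    {P : Measure Ω} [IsProbabilityMeasure P] {μ : Measure E} [IsProbabilityMeasure μ]
    {X : η → Ω → E} (hX : ∀ i, HasLaw (X i) μ P) (hind : iIndepFun X P)
    {e : ι × κ → η} (he : Function.Injective e) :
    iIndepFun (fun j ω l => X (e (j, l)) ω) P :=
  (iIndepFun_iff_hasLaw_pi_pi fun j => (hind.precomp (g := fun l => e (j, l))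
    fun _ _ h => (Prod.ext_iff.1 (he h)).2).hasLaw_pi fun l => hX (e (j, l))).2
    (hasLaw_curry_comp hX hind he)

/-! ### Moments of U-statistics -/

/-- The power of `N` in the final bound: `M` is the number of increasing tuples and `k` the number
of blocks, which is at least `N / (2 n)`. -/
theorem rpow_block_bound {n N k : ℕ} {p A : ℝ} (hn : 0 < n) (hp : 0 ≤ p) (hA : 0 ≤ A)
    (hk : 0 < k) (hN : N ≤ 2 * n * k) {M : ℝ} (hM0 : 0 ≤ M) (hM : M ≤ (N : ℝ) ^ n) :
    (M / k) ^ p * (A * k) ^ (p / 2) ≤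
      (2 * n * A) ^ (p / 2) * (N : ℝ) ^ (p * ((n : ℝ) - 1 / 2)) := by
  have hk0 : (0 : ℝ) < k := by exact_mod_cast hk
  obtain ⟨d, rfl⟩ : ∃ d, n = d + 1 := ⟨n - 1, by omega⟩
  -- Both sides are `(p / 2)`-th powers, so it suffices to compare the bases.
  have e1 : (M / k) ^ p = ((M / k) ^ 2) ^ (p / 2) := by
    rw [← Real.rpow_natCast, ← Real.rpow_mul (by positivity)]
    congr 1; push_cast; ring
  have e2 : (N : ℝ) ^ (p * (((d + 1 : ℕ) : ℝ) - 1 / 2)) = ((N : ℝ) ^ (2 * d + 1)) ^ (p / 2) := by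
    rw [← Real.rpow_natCast, ← Real.rpow_mul (by positivity)]
    congr 1; push_cast; ring
  rw [e1, e2, ← Real.mul_rpow (by positivity) (by positivity),
    ← Real.mul_rpow (by positivity) (by positivity)]
  refine Real.rpow_le_rpow (by positivity) ?_ (by positivity)
  have hN' : (N : ℝ) ≤ 2 * ((d + 1 : ℕ) : ℝ) * k := by exact_mod_cast hN
  have e3 : (M / k) ^ 2 * (A * k) = M ^ 2 * A / k := by field_simp
  rw [e3, div_le_iff₀ hk0]
  calc M ^ 2 * A ≤ ((N : ℝ) ^ (d + 1)) ^ 2 * A := by gcongr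
    _ = (N : ℝ) ^ (2 * d + 1) * A * N := by ring
    _ ≤ (N : ℝ) ^ (2 * d + 1) * A * (2 * ((d + 1 : ℕ) : ℝ) * k) := by gcongr
    _ = _ := by ring

/-- The moment bound for the unnormalized U-statistic of any symmetric centred kernel. -/
theorem integral_abs_increasingSum_rpow_le {Ω E : Type*} [MeasurableSpace Ω] [MeasurableSpace E]
    {n N : ℕ} {p : ℝ} (hn : 0 < n) (hp : 2 ≤ p)
    {P : Measure Ω} [IsProbabilityMeasure P] {μ : Measure E} [IsProbabilityMeasure μ]
    {X : Fin N → Ω → E} (hX : ∀ i, HasLaw (X i) μ P) (hind : iIndepFun X P)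
    {f : (Fin n → E) → ℝ} (hf : Measurable f)
    (hsymm : ∀ (τ : Equiv.Perm (Fin n)) x, f (x ∘ τ) = f x)
    (hi : Integrable (fun x => |f x| ^ p) (Measure.pi fun _ => μ))
    (h0 : ∫ x, f x ∂(Measure.pi fun _ => μ) = 0) :
    Integrable (fun ω => |increasingSum f (fun i => X i ω)| ^ p) P ∧
      ∫ ω, |increasingSum f (fun i => X i ω)| ^ p ∂P ≤
        (2 * n * (2 * (p ^ 2 * 2 ^ p))) ^ (p / 2) * (N : ℝ) ^ (p * ((n : ℝ) - 1 / 2)) *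
          ∫ x, |f x| ^ p ∂(Measure.pi fun _ => μ) := by
  have hp0 : 0 < p := by linarith
  have hm0 : 0 ≤ ∫ x, |f x| ^ p ∂(Measure.pi fun _ => μ) := integral_nonneg fun x => by positivity
  rcases lt_or_ge N n with hNn | hNn
  · have : IsEmpty (Fin n ↪o Fin N) := ⟨fun i => by
      have := Fintype.card_le_of_injective i i.injective
      simp only [Fintype.card_fin] at this
      omega⟩
    simp only [increasingSum, Finset.univ_eq_empty, Finset.sum_empty, abs_zero,
      Real.zero_rpow hp0.ne', integral_zero]
    exact ⟨integrable_zero _ _ _, by positivity⟩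
  obtain ⟨k, hk⟩ : ∃ k, k = N / n := ⟨_, rfl⟩
  have hk1 : 0 < k := hk ▸ Nat.div_pos hNn hn
  have hkN : k * n ≤ N := hk ▸ Nat.div_mul_le_self N n
  have hNk : N ≤ 2 * n * k := by
    have h1 := Nat.lt_mul_div_succ N hn
    rw [← hk] at h1
    nlinarith
  have hk0 : (0 : ℝ) < k := by exact_mod_cast hk1
  let e : Fin k × Fin n → Fin N := fun q => Fin.castLE hkN (finProdFinEquiv q)
  have he : Function.Injective e := (Fin.castLE_injective hkN).comp finProdFinEquiv.injective
  -- The block sums in Hoeffding's representation, one for each permutation of the indices.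
  let T : Equiv.Perm (Fin N) → Ω → ℝ := fun σ ω => ∑ j : Fin k, f fun l => X (σ (e (j, l))) ω
  set m := ∫ x, |f x| ^ p ∂(Measure.pi fun _ => μ) with hm
  have hT : ∀ σ, Integrable (fun ω => |T σ ω| ^ p) P ∧
      ∫ ω, |T σ ω| ^ p ∂P ≤ (2 * (p ^ 2 * 2 ^ p) * (k : ℝ)) ^ (p / 2) * m := fun σ => by
    have hσe : Function.Injective fun q => σ (e q) := σ.injective.comp he
    have hlaw : ∀ j, HasLaw (fun ω l => X (σ (e (j, l))) ω) (Measure.pi fun _ => μ) P := fun j =>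
      (hind.precomp (g := fun l => σ (e (j, l)))
        fun _ _ h => (Prod.ext_iff.1 (hσe h)).2).hasLaw_pi fun l => hX _
    have hfp : Measurable fun x => |f x| ^ p := by fun_prop
    have := integral_abs_sum_rpow_le (P := P) (m := m)
      (Y := fun j ω => f fun l => X (σ (e (j, l))) ω) hp
      (fun j => hf.comp_aemeasurable (hlaw j).aemeasurable)
      ((iIndepFun_blocks hX hind hσe).comp (fun _ => f) fun _ => hf)
      (fun j => by
        have h := hi
        rw [← (hlaw j).map_eq] at h
        exact h.comp_aemeasurable (hlaw j).aemeasurable)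
      (fun j => ((hlaw j).integral_comp hf.aestronglyMeasurable).trans h0)
      (fun j => ((hlaw j).integral_comp hfp.aestronglyMeasurable).le) Finset.univ
    simpa only [Finset.card_fin] using this
  obtain ⟨G, hG⟩ : ∃ G : ℕ, G = Fintype.card (Equiv.Perm (Fin N)) := ⟨_, rfl⟩
  have hG0 : (0 : ℝ) < G := by rw [hG]; exact_mod_cast Fintype.card_pos
  obtain ⟨M, hM⟩ : ∃ M : ℕ, M = Fintype.card (Fin n ↪o Fin N) := ⟨_, rfl⟩
  have hMN : (M : ℝ) ≤ (N : ℝ) ^ n := by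
    have := Fintype.card_le_of_injective (fun (i : Fin n ↪o Fin N) => (i : Fin n → Fin N))
      DFunLike.coe_injective
    rw [← hM, Fintype.card_fun, Fintype.card_fin, Fintype.card_fin] at this
    exact_mod_cast this
  have hS : ∀ ω, increasingSum f (fun i => X i ω) = M / k * ∑ σ, (G : ℝ)⁻¹ * T σ ω := fun ω => by
    have := mul_sum_orderEmbedding_eq (F := fun i : Fin n → Fin N => f fun l => X (i l) ω)
      (fun τ i => hsymm τ fun l => X (i l) ω) he
    rw [← hG, ← hM] at this
    rw [← Finset.mul_sum]
    change (k : ℝ) * (G * increasingSum f (fun i => X i ω)) = M * ∑ σ, T σ ω at this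
    field_simp
    linarith
  have hle : ∀ ω, |increasingSum f (fun i => X i ω)| ^ p ≤
      (M / k : ℝ) ^ p * ∑ σ, (G : ℝ)⁻¹ * |T σ ω| ^ p := fun ω => by
    rw [hS, abs_mul, abs_of_nonneg (by positivity : (0 : ℝ) ≤ M / k),
      Real.mul_rpow (by positivity) (abs_nonneg _)]
    gcongr
    -- Jensen's inequality for the average over all permutations.
    refine le_trans ?_ (Real.rpow_arith_mean_le_arith_mean_rpow Finset.univ (fun _ => (G : ℝ)⁻¹)
      (fun σ => |T σ ω|) (fun _ _ => by positivity) ?_ (fun _ _ => abs_nonneg _) (by linarith))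
    · refine Real.rpow_le_rpow (abs_nonneg _) ((Finset.abs_sum_le_sum_abs _ _).trans_eq ?_) hp0.le
      refine Finset.sum_congr rfl fun σ _ => ?_
      rw [abs_mul, abs_of_nonneg (by positivity : (0 : ℝ) ≤ (G : ℝ)⁻¹)]
    · rw [Finset.sum_const, Finset.card_univ, ← hG, nsmul_eq_mul, mul_inv_cancel₀ hG0.ne']
  have hdom : Integrable (fun ω => (M / k : ℝ) ^ p * ∑ σ, (G : ℝ)⁻¹ * |T σ ω| ^ p) P :=
    (integrable_finsetSum _ fun σ _ => ((hT σ).1.const_mul _)).const_mul _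
  have hmeas : AEMeasurable (fun ω => increasingSum f (fun i => X i ω)) P :=
    Finset.aemeasurable_fun_sum _ fun i _ =>
      hf.comp_aemeasurable (aemeasurable_pi_lambda _ fun l => (hX (i l)).aemeasurable)
  have hint : Integrable (fun ω => |increasingSum f (fun i => X i ω)| ^ p) P := by
    refine hdom.mono' ((by fun_prop : Measurable fun a : ℝ => |a| ^ p).comp_aemeasurable
      hmeas).aestronglyMeasurable (Filter.Eventually.of_forall fun ω => ?_)
    rw [Real.norm_of_nonneg (by positivity)]
    exact hle ω
  refine ⟨hint, (integral_mono hint hdom hle).trans ?_⟩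
  rw [integral_const_mul, integral_finsetSum _ fun σ _ => (hT σ).1.const_mul _]
  simp only [integral_const_mul]
  calc _ ≤ (M / k : ℝ) ^ p * ∑ σ : Equiv.Perm (Fin N),
        (G : ℝ)⁻¹ * ((2 * (p ^ 2 * 2 ^ p) * (k : ℝ)) ^ (p / 2) * m) := by
        gcongr with σ
        exact (hT σ).2
    _ = (M / k : ℝ) ^ p * (2 * (p ^ 2 * 2 ^ p) * (k : ℝ)) ^ (p / 2) * m := by
        rw [Finset.sum_const, Finset.card_univ, ← hG, nsmul_eq_mul]
        field_simp
    _ ≤ _ := by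
        refine mul_le_mul_of_nonneg_right ?_ hm0
        exact rpow_block_bound hn hp0.le (by positivity) hk1 hNk (by positivity) hMN

/-! ### The determinant kernel -/

theorem measurable_absDet {n : ℕ} : Measurable (absDet (n := n)) := by
  unfold absDet
  refine Continuous.measurable ?_
  refine (Continuous.matrix_det ?_).abs
  fun_prop

theorem absDet_comp_perm {n : ℕ} (τ : Equiv.Perm (Fin n)) (x : Fin n → EuclideanSpace ℝ (Fin n)) :
    absDet (x ∘ τ) = absDet x := by
  have h := Matrix.det_permute' τ (Matrix.of fun i j : Fin n => x j i)
  have e : (Matrix.of fun i j : Fin n => (x ∘ τ) j i) =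
      (Matrix.of fun i j : Fin n => x j i).submatrix id τ := rfl
  rw [absDet, absDet, e, h, abs_mul]
  rcases Int.units_eq_one_or (Equiv.Perm.sign τ) with h | h <;> simp [h]

theorem corollary3p6 (n : ℕ) (p : ℝ) (hp : 2 ≤ p) :
    ∃ C : ℝ, 0 < C ∧
      ∀ (μ : Measure (EuclideanSpace ℝ (Fin n))) [IsProbabilityMeasure μ],
        μ ≪ volume →
        Integrable (fun x => absDet x ^ p) (iidLaw μ) →
        ∀ (N : ℕ) {Ω : Type*} [MeasurableSpace Ω] (P : Measure Ω) [IsProbabilityMeasure P]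
          (X : Fin N → Ω → EuclideanSpace ℝ (Fin n)),
          (∀ i, HasLaw (X i) μ P) →
          iIndepFun X P →
          Integrable
            (fun ω => |increasingSum (detKernel μ) (fun i => X i ω)| ^ p) P ∧
          ∫ ω, |increasingSum (detKernel μ) (fun i => X i ω)| ^ p ∂P ≤
            C * (N : ℝ) ^ (p * ((n : ℝ) - 1 / 2)) *
              ∫ x, |detKernel μ x| ^ p ∂(iidLaw μ) := by
  have hp0 : 0 < p := by linarith
  rcases Nat.eq_zero_or_pos n with rfl | hn
  -- In dimension zero the determinant is `1`, so the centred kernel vanishes.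
  · refine ⟨1, one_pos, fun μ _ _ _ N Ω _ P _ X _ _ => ?_⟩
    have : IsProbabilityMeasure (iidLaw μ) := by unfold iidLaw; infer_instance
    have h : ∀ x, detKernel μ x = 0 := fun x => by simp [detKernel, absDet]
    simp [increasingSum, h, Real.zero_rpow hp0.ne']
  refine ⟨(2 * n * (2 * (p ^ 2 * 2 ^ p))) ^ (p / 2), by positivity,
    fun μ _ _ hint N Ω _ P _ X hX hind => ?_⟩
  have : IsProbabilityMeasure (iidLaw μ) := by unfold iidLaw; infer_instance
  have habs : ∀ x : Fin n → EuclideanSpace ℝ (Fin n), |absDet x| = absDet x := fun x => abs_abs _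
  have hintp : Integrable (fun x => |absDet x| ^ p) (iidLaw μ) := by simpa only [habs] using hint
  have hdet : Integrable absDet (iidLaw μ) := by
    have h := integrable_norm_rpow_of_le (p := 1) measurable_absDet.aestronglyMeasurable
      zero_le_one hp0.le (by linarith) hintp
    simpa only [Real.rpow_one, Real.norm_eq_abs, habs] using h
  have hmeas : Measurable (detKernel μ) := measurable_absDet.sub_const _
  have hker : Integrable (fun x => |detKernel μ x| ^ p) (iidLaw μ) := by
    simp only [detKernel, sub_eq_add_neg]
    exact integrable_abs_add_rpow hp0 measurable_absDet.aestronglyMeasurable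
      aestronglyMeasurable_const hintp (integrable_const _)
  have hmean : ∫ x, detKernel μ x ∂(iidLaw μ) = 0 := by
    simp only [detKernel]
    rw [integral_sub hdet (integrable_const _)]
    simp
  exact integral_abs_increasingSum_rpow_le hn hp hX hind hmeas
    (fun τ x => by simp only [detKernel, absDet_comp_perm]) hker hmean
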